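/- For complex numbers $a,p$ with $|p|<1$ let $(a;p)_\infty=\lim_{n\to\infty}\prod_{k=0}^{n-1}(1-ap^k)=\prod_{k=0}^{\infty}(1-ap^k)$. **Theorem 1.1.** Let $q$ be a complex number with $|q|<1$. Then $1-q^{2k+1}\neq0$ for all integers $k\ge0$, $(q;q^2)_\infty\ne0$, $(q^4;q^8)_\infty\neq0$, the series below converges absolutely, and $$\sum_{k=0}^{\infty}\frac{(-1)^k q^{k(k+3)/2}}{1-q^{2k+1}}=\frac{(q^2;q^2)_\infty\,(q^8;q^8)_\infty}{(q;q^2)_\infty\,(q^4;q^8)_\infty}.$$ -/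

import Mathlib

/-- The finite `q`-shifted factorial `(a;q)_n = ∏_{k=0}^{n-1} (1 - a q^k)`. -/
def qPoch (a q : ℂ) (n : ℕ) : ℂ := ∏ k ∈ Finset.range n, (1 - a * q ^ k)

/-- The infinite `q`-shifted factorial `(a;q)_∞ = ∏_{k=0}^∞ (1 - a q^k)`. -/
noncomputable def qPochInf (a q : ℂ) : ℂ := ∏' k : ℕ, (1 - a * q ^ k)

/-- For `|q| < 1` the infinite product converges unconditionally, for every `a`. -/
theorem hasProd_qPochInf (a q : ℂ) (hq : ‖q‖ < 1) :
    HasProd (fun k : ℕ => 1 - a * q ^ k) (qPochInf a q) := by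
  have h : Summable (fun k : ℕ => ‖-(a * q ^ k)‖) := by
    simpa [norm_mul, norm_pow] using
      (summable_geometric_of_lt_one (norm_nonneg q) hq).mul_left ‖a‖
  have h2 := (multipliable_one_add_of_summable h).hasProd
  simpa [qPochInf, sub_eq_add_neg] using h2

/-- For `|q| < 1`, `(a;q)_∞ = lim_{n → ∞} (a;q)_n`. -/
theorem tendsto_qPoch (a q : ℂ) (hq : ‖q‖ < 1) :
    Filter.Tendsto (qPoch a q) Filter.atTop (nhds (qPochInf a q)) :=
  (hasProd_qPochInf a q hq).tendsto_prod_nat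

/-!
Write `q = s²`. Since `1/(1 - u) - 1/(1 + u) = 2u / (1 - u²)`, the series is obtained by taking the
partial fraction expansion of a reciprocal theta product,
`(q;q)_∞² / ((z;q)_∞ (q/z;q)_∞) = ∑_{k ∈ ℤ} (-1)^k q^{k(k+1)/2} / (1 - z q^k)`,
at `z = s` and at `z = -s` and subtracting; the terms of index `k` and `-(k + 1)` then coincide, and
the result is `4s` times the series (`hasSum_lambertTerm`). As `(s;q)_∞ (-s;q)_∞ = (q;q²)_∞`, the
series equals `(q;q)_∞² ((-s;q)_∞² - (s;q)_∞²) / (4s (q;q²)_∞²)`.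

By the Jacobi triple product (`hasSum_thetaTerm`), `(q;q)_∞ (±s;q)_∞² = ∑_{k ∈ ℤ} (∓1)^k s^{k²}`, so
the difference is twice the sum of `s^{m²}` over odd `m`, which is again a theta series, with base
`q⁴ = s⁸`. The triple product turns it into `4s (q⁴;q⁴)_∞ (-q⁴;q⁴)_∞²` (`qPochInf_mul_sub_sq`).
Elementary product identities, among them Euler's `(-q;q)_∞ (q;q²)_∞ = 1`, finish the proof.

Both bilateral expansions are limits of finite ones with weights `1 / ((q;q)_{b+k} (q;q)_{a-k})`,
which vanish for all but finitely many `k` (`hasSum_thetaTerm_mul_qFactInv`,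
`hasSum_thetaTerm_div_mul_qFactInv`). The finite identities are proved by induction on `a` and `b`,
and `hasSum_of_hasSum_mul_qFactInv` passes to the limit by dominated convergence.
-/

open Filter Topology

theorem HasSum.congr_eq {ι : Type*} {f g : ι → ℂ} {s t : ℂ} (h : HasSum f s)
    (hfg : ∀ i, g i = f i) (hst : t = s) : HasSum g t := by
  rw [funext hfg, hst]
  exact h

/-! ### Finite and infinite `q`-shifted factorials -/

/-- An infinite `q`-shifted factorial without a vanishing factor does not vanish. -/
theorem qPochInf_ne_zero {a q : ℂ} (hq : ‖q‖ < 1) (h : ∀ k : ℕ, 1 - a * q ^ k ≠ 0) :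
    qPochInf a q ≠ 0 := by
  have hs : Summable (fun k : ℕ => ‖-(a * q ^ k)‖) := by
    simpa [norm_mul, norm_pow] using
      (summable_geometric_of_lt_one (norm_nonneg q) hq).mul_left ‖a‖
  have := tprod_one_add_ne_zero_of_summable (f := fun k : ℕ => -(a * q ^ k))
    (fun i => by simpa [← sub_eq_add_neg] using h i) hs
  simpa [qPochInf, sub_eq_add_neg] using this

theorem one_sub_ne_zero_of_norm_lt_one {z : ℂ} (hz : ‖z‖ < 1) : 1 - z ≠ 0 := by
  intro h
  rw [← sub_eq_zero.1 h] at hz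
  simp at hz

theorem norm_pow_lt_one {q : ℂ} (hq : ‖q‖ < 1) {n : ℕ} (hn : n ≠ 0) : ‖q ^ n‖ < 1 := by
  rw [norm_pow]
  exact pow_lt_one₀ (norm_nonneg q) hq hn

theorem one_sub_pow_ne_zero {q : ℂ} (hq : ‖q‖ < 1) {n : ℕ} (hn : n ≠ 0) : 1 - q ^ n ≠ 0 :=
  one_sub_ne_zero_of_norm_lt_one (norm_pow_lt_one hq hn)

theorem qPochInf_ne_zero_of_norm_lt_one {a q : ℂ} (ha : ‖a‖ < 1) (hq : ‖q‖ < 1) :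
    qPochInf a q ≠ 0 :=
  qPochInf_ne_zero hq fun k => one_sub_ne_zero_of_norm_lt_one (by
    rw [norm_mul, norm_pow]
    exact mul_lt_one_of_nonneg_of_lt_one_left (norm_nonneg a) ha
      (pow_le_one₀ (norm_nonneg q) hq.le))

theorem qPochInf_mul_qPochInf_neg (a : ℂ) {q : ℂ} (hq : ‖q‖ < 1) :
    qPochInf a q * qPochInf (-a) q = qPochInf (a ^ 2) (q ^ 2) := by
  have h := (hasProd_qPochInf a q hq).mul (hasProd_qPochInf (-a) q hq)
  refine h.unique ?_
  convert hasProd_qPochInf (a ^ 2) (q ^ 2) (norm_pow_lt_one hq two_ne_zero) using 2 with k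
  ring

theorem qPochInf_even_mul_odd (a : ℂ) {q : ℂ} (hq : ‖q‖ < 1) :
    qPochInf a (q ^ 2) * qPochInf (a * q) (q ^ 2) = qPochInf a q := by
  have hq2 := norm_pow_lt_one hq two_ne_zero
  refine (HasProd.even_mul_odd ?_ ?_).unique (hasProd_qPochInf a q hq)
  · convert hasProd_qPochInf a (q ^ 2) hq2 using 2 with k
    ring
  · convert hasProd_qPochInf (a * q) (q ^ 2) hq2 using 2 with k
    ring

theorem qPochInf_neg_one {q : ℂ} (hq : ‖q‖ < 1) : qPochInf (-1) q = 2 * qPochInf (-q) q := by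
  have h1 := (tendsto_qPoch (-1) q hq).comp (tendsto_add_atTop_nat 1)
  refine tendsto_nhds_unique h1 (((tendsto_qPoch (-q) q hq).const_mul 2).congr fun n => ?_)
  simp only [qPoch, Function.comp, Finset.prod_range_succ' _ n]
  rw [mul_comm]
  congr 1
  · exact Finset.prod_congr rfl fun k _ => by ring
  · norm_num

/-- Euler's identity `(-q;q)_∞ (q;q²)_∞ = 1`. -/
theorem qPochInf_neg_mul_qPochInf_odd {q : ℂ} (hq : ‖q‖ < 1) :
    qPochInf (-q) q * qPochInf q (q ^ 2) = 1 := by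
  have hq2 := norm_pow_lt_one hq two_ne_zero
  have h0 := qPochInf_ne_zero_of_norm_lt_one hq2 hq2
  have h1 := qPochInf_mul_qPochInf_neg q hq
  have h2 := qPochInf_even_mul_odd q hq
  rw [← pow_two q] at h2
  apply mul_right_cancel₀ h0
  rw [← h2] at h1
  linear_combination h1

/-! ### The reciprocal of `(q;q)_m` for integers `m` -/

/-- The reciprocal `1 / (q;q)_m`, extended to all integers `m` by `0` for negative `m`. With this
convention the relation `1 / (q;q)_{m-1} = (1 - q^m) / (q;q)_m` holds for every integer `m`. -/
noncomputable def qFactInv (q : ℂ) (m : ℤ) : ℂ :=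
  if 0 ≤ m then (qPoch q q m.toNat)⁻¹ else 0

theorem qFactInv_natCast (q : ℂ) (n : ℕ) : qFactInv q n = (qPoch q q n)⁻¹ := by
  simp [qFactInv]

theorem qFactInv_of_neg (q : ℂ) {m : ℤ} (hm : m < 0) : qFactInv q m = 0 := by
  simp [qFactInv, not_le.2 hm]

theorem qFactInv_zero (q : ℂ) : qFactInv q 0 = 1 := by
  simp [qFactInv, qPoch]

theorem qPoch_succ (a q : ℂ) (n : ℕ) : qPoch a q (n + 1) = qPoch a q n * (1 - a * q ^ n) := by
  rw [qPoch, Finset.prod_range_succ, ← qPoch]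

theorem qPoch_one_succ (q : ℂ) (n : ℕ) : qPoch 1 q (n + 1) = 0 :=
  Finset.prod_eq_zero (Finset.mem_range.2 n.succ_pos) (by simp)

theorem qPoch_self_succ (q : ℂ) (n : ℕ) :
    qPoch q q (n + 1) = qPoch q q n * (1 - q ^ (n + 1)) := by
  rw [qPoch_succ, pow_succ']

theorem qPoch_self_ne_zero {q : ℂ} (hq : ‖q‖ < 1) (n : ℕ) : qPoch q q n ≠ 0 :=
  Finset.prod_ne_zero_iff.2 fun k _ => by
    rw [← pow_succ']
    exact one_sub_pow_ne_zero hq k.succ_ne_zero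

theorem qFactInv_eq_mul_qFactInv_add_one {q : ℂ} (hq : ‖q‖ < 1) (m : ℤ) :
    qFactInv q m = (1 - q ^ (m + 1)) * qFactInv q (m + 1) := by
  rcases lt_trichotomy m (-1) with h | rfl | h
  · rw [qFactInv_of_neg q (by omega), qFactInv_of_neg q (by omega), mul_zero]
  · simp [qFactInv_of_neg]
  · lift m to ℕ using by omega
    have h1 := one_sub_pow_ne_zero hq m.succ_ne_zero
    have h2 := qPoch_self_ne_zero hq m
    have : ((m : ℤ) + 1) = ((m + 1 : ℕ) : ℤ) := by push_cast; ring
    rw [this, qFactInv_natCast, qFactInv_natCast, qPoch_self_succ, zpow_natCast]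
    field_simp

theorem tendsto_qFactInv {q : ℂ} (hq : ‖q‖ < 1) :
    Tendsto (qFactInv q) atTop (𝓝 (qPochInf q q)⁻¹) := by
  have h := (tendsto_qPoch q q hq).inv₀ (qPochInf_ne_zero_of_norm_lt_one hq hq)
  have ht : Tendsto Int.toNat atTop atTop :=
    tendsto_atTop.2 fun b => (eventually_ge_atTop (b : ℤ)).mono fun m hm => by omega
  refine (h.comp ht).congr' ?_
  filter_upwards [eventually_ge_atTop 0] with m hm
  simp [qFactInv, hm]

theorem exists_norm_qFactInv_le {q : ℂ} (hq : ‖q‖ < 1) : ∃ C, ∀ m, ‖qFactInv q m‖ ≤ C := by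
  have h := (tendsto_qPoch q q hq).inv₀ (qPochInf_ne_zero_of_norm_lt_one hq hq)
  obtain ⟨C, hC⟩ := (Metric.isBounded_range_of_tendsto _ h).exists_norm_le
  refine ⟨C, fun m => ?_⟩
  rcases lt_or_ge m 0 with hm | hm
  · rw [qFactInv_of_neg q hm, norm_zero]
    exact (norm_nonneg _).trans (hC _ ⟨0, rfl⟩)
  · lift m to ℕ using hm
    rw [qFactInv_natCast]
    exact hC _ ⟨m, rfl⟩

/-- Passage to the limit in sums weighted by `1 / ((q;q)_{n+b} (q;q)_{n+c})`: by dominated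
convergence, every weight may be replaced by its limit `1 / (q;q)_∞²`. -/
theorem hasSum_of_hasSum_mul_qFactInv {ι : Type*} {q : ℂ} (hq : ‖q‖ < 1) {w : ι → ℂ}
    (hw : Summable fun i => ‖w i‖) (b c : ι → ℤ) {S : ℕ → ℂ} {L : ℂ}
    (hS : ∀ n : ℕ, HasSum (fun i => w i * qFactInv q (n + b i) * qFactInv q (n + c i)) (S n))
    (hL : Tendsto S atTop (𝓝 L)) : HasSum w (qPochInf q q ^ 2 * L) := by
  obtain ⟨C, hC⟩ := exists_norm_qFactInv_le hq
  have hP := qPochInf_ne_zero_of_norm_lt_one hq hq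
  have hC0 : 0 ≤ C := (norm_nonneg _).trans (hC 0)
  have ht : ∀ d : ℤ, Tendsto (fun n : ℕ => qFactInv q (n + d)) atTop (𝓝 (qPochInf q q)⁻¹) :=
    fun d => (tendsto_qFactInv hq).comp
      (tendsto_atTop_add_const_right _ d tendsto_natCast_atTop_atTop)
  have hlim := tendsto_tsum_of_dominated_convergence
    (f := fun (n : ℕ) i => w i * qFactInv q (n + b i) * qFactInv q (n + c i))
    (g := fun i => w i * (qPochInf q q)⁻¹ * (qPochInf q q)⁻¹)
    (bound := fun i => ‖w i‖ * C * C) (𝓕 := atTop) ((hw.mul_right C).mul_right C)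
    (fun i => ((ht (b i)).const_mul (w i)).mul (ht (c i)))
    (Eventually.of_forall fun n i => by
      rw [norm_mul, norm_mul]
      gcongr
      · exact hC _
      · exact hC _)
  simp only [fun n => (hS n).tsum_eq] at hlim
  have he := tendsto_nhds_unique hL hlim
  rw [tsum_mul_right, tsum_mul_right] at he
  refine hw.of_norm.hasSum.congr_eq (fun _ => rfl) ?_
  rw [he, pow_two, mul_assoc, mul_comm (tsum w), mul_assoc, mul_inv_cancel_left₀ hP,
    mul_comm (tsum w), mul_inv_cancel_left₀ hP]

/-! ### The Jacobi triple product -/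

/-- The general term `(-1)^k q^{k(k-1)/2} x^k` of the bilateral theta series. The division
`k * (k - 1) / 2` of integers is exact. -/
noncomputable def thetaTerm (q x : ℂ) (k : ℤ) : ℂ := (-1) ^ k * q ^ (k * (k - 1) / 2) * x ^ k

theorem thetaTerm_zero (q x : ℂ) : thetaTerm q x 0 = 1 := by simp [thetaTerm]

theorem thetaTerm_mul (q x y : ℂ) (k : ℤ) : thetaTerm q (x * y) k = thetaTerm q x k * y ^ k := by
  rw [thetaTerm, thetaTerm, mul_zpow]
  ring

theorem thetaTerm_add_one {q x : ℂ} (hq0 : q ≠ 0) (hx : x ≠ 0) (k : ℤ) :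
    thetaTerm q x (k + 1) = -x * q ^ k * thetaTerm q x k := by
  have h : (k + 1) * (k + 1 - 1) / 2 = k * (k - 1) / 2 + k := by
    rw [show (k + 1) * (k + 1 - 1) = k * (k - 1) + k * 2 by ring,
      Int.add_mul_ediv_right _ _ two_ne_zero]
  rw [thetaTerm, thetaTerm, h, zpow_add₀ hq0, zpow_add_one₀ hx,
    zpow_add_one₀ (neg_ne_zero.2 one_ne_zero)]
  ring

theorem summable_norm_thetaTerm {q x : ℂ} (hq0 : q ≠ 0) (hq : ‖q‖ < 1) (hx : x ≠ 0) :
    Summable fun k => ‖thetaTerm q x k‖ := by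
  have key : ∀ (f : ℕ → ℂ) (c : ℂ), (∀ n, f (n + 1) = c * q ^ n * f n) →
      Summable fun n => ‖f n‖ := by
    intro f c hf
    have ht : Tendsto (fun n : ℕ => ‖c * q ^ n‖) atTop (𝓝 0) := by
      simpa using ((tendsto_pow_atTop_nhds_zero_of_norm_lt_one hq).const_mul c).norm
    refine summable_of_ratio_norm_eventually_le (r := 1 / 2) (by norm_num) ?_
    filter_upwards [ht.eventually_le_const (show (0 : ℝ) < 1 / 2 by norm_num)] with n hn
    rw [norm_norm, norm_norm, hf, norm_mul]
    gcongr
  refine Summable.of_nat_of_neg (key (fun n => thetaTerm q x n) (-x) fun n => ?_)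
    (key (fun n => thetaTerm q x (-n)) (-x⁻¹ * q) fun n => ?_)
  · simpa using thetaTerm_add_one hq0 hx n
  · have h := thetaTerm_add_one hq0 hx (-((n : ℤ) + 1))
    rw [show -((n : ℤ) + 1) + 1 = -n by ring, zpow_neg, zpow_add_one₀ hq0, zpow_natCast] at h
    push_cast
    rw [h]
    field_simp

/-- The finite Jacobi triple product (equivalent to the `q`-binomial theorem):
`∑_k (-1)^k q^{k(k-1)/2} x^k / ((q;q)_{b+k} (q;q)_{a-k}) = (x;q)_a (q/x;q)_b / (q;q)_{a+b}`. -/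
theorem hasSum_thetaTerm_mul_qFactInv {q x : ℂ} (hq0 : q ≠ 0) (hq : ‖q‖ < 1) (hx : x ≠ 0)
    (a b : ℕ) :
    HasSum (fun k : ℤ => thetaTerm q x k * qFactInv q (b + k) * qFactInv q (a - k))
      (qPoch x q a * qPoch (q / x) q b * qFactInv q (a + b)) := by
  have hne (n : ℕ) : 1 - q ^ (n + 1) ≠ 0 := one_sub_pow_ne_zero hq n.succ_ne_zero
  induction a with
  | zero =>
    induction b with
    | zero =>
      convert hasSum_single (0 : ℤ) fun k hk => ?_ using 1
      · simp [thetaTerm_zero, qFactInv_zero, qPoch]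
      · rcases lt_or_gt_of_ne hk with h | h
        · simp [qFactInv_of_neg q h]
        · simp [qFactInv_of_neg q (neg_lt_zero.2 h)]
    | succ b ih =>
      -- multiplication by `1 - (q / x) q^b`: the second part is shifted by one index
      have h2 := ((Equiv.addRight (1 : ℤ)).hasSum_iff.2 ih).mul_left (-(q / x * q ^ b))
      refine HasSum.congr_eq ((ih.add h2).mul_right (1 - q ^ (b + 1))⁻¹) (fun k => ?_) ?_
      · have e1 := qFactInv_eq_mul_qFactInv_add_one hq (b + k)
        have e2 := qFactInv_eq_mul_qFactInv_add_one hq (-k - 1)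
        have hk := zpow_ne_zero k hq0
        rw [show (b : ℤ) + k + 1 = b + 1 + k by ring, zpow_add₀ hq0, zpow_add_one₀ hq0,
          zpow_natCast] at e1
        rw [sub_add_cancel, zpow_neg] at e2
        simp only [Function.comp, Equiv.coe_addRight, Nat.cast_zero, zero_sub, Nat.cast_succ]
        rw [show -(k + 1) = -k - 1 by ring, show (b : ℤ) + (k + 1) = b + 1 + k by ring, e1, e2,
          thetaTerm_add_one hq0 hx, eq_mul_inv_iff_mul_eq₀ (hne b)]
        field_simp
        ring
      · have e := qFactInv_eq_mul_qFactInv_add_one hq b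
        rw [zpow_add_one₀ hq0, zpow_natCast] at e
        simp only [Nat.cast_zero, zero_add, Nat.cast_succ]
        rw [e, qPoch_succ, eq_mul_inv_iff_mul_eq₀ (hne b)]
        ring
  | succ a ih =>
    -- multiplication by `1 - x q^a`: the second part is shifted by one index
    have h2 := ((Equiv.addRight (-1 : ℤ)).hasSum_iff.2 ih).mul_left (-(x * q ^ a))
    refine HasSum.congr_eq ((ih.add h2).mul_right (1 - q ^ (a + b + 1))⁻¹) (fun k => ?_) ?_
    · obtain ⟨k, rfl⟩ : ∃ l, k = l + 1 := ⟨k - 1, by ring⟩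
      have e1 := qFactInv_eq_mul_qFactInv_add_one hq (b + k)
      have e2 := qFactInv_eq_mul_qFactInv_add_one hq (a - k - 1)
      have hk := zpow_ne_zero k hq0
      rw [show (b : ℤ) + k + 1 = b + 1 + k by ring, zpow_add₀ hq0, zpow_add_one₀ hq0,
        zpow_natCast] at e1
      rw [sub_add_cancel, zpow_sub₀ hq0, zpow_natCast] at e2
      simp only [Function.comp, Equiv.coe_addRight, Nat.cast_succ, add_neg_cancel_right]
      rw [show (a : ℤ) - (k + 1) = a - k - 1 by ring, show (a : ℤ) + 1 - (k + 1) = a - k by ring,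
        show (b : ℤ) + (k + 1) = b + 1 + k by ring, e1, e2,
        thetaTerm_add_one hq0 hx, eq_mul_inv_iff_mul_eq₀ (hne (a + b))]
      field_simp
      ring
    · have e := qFactInv_eq_mul_qFactInv_add_one hq (a + b)
      rw [zpow_add_one₀ hq0, zpow_add₀ hq0, zpow_natCast, zpow_natCast] at e
      rw [Nat.cast_succ, show (a : ℤ) + 1 + b = a + b + 1 by ring, e, qPoch_succ,
        eq_mul_inv_iff_mul_eq₀ (hne (a + b))]
      ring

/-- The Jacobi triple product
`∑_k (-1)^k q^{k(k-1)/2} x^k = (q;q)_∞ (x;q)_∞ (q/x;q)_∞`, the sum being over all integers. -/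
theorem hasSum_thetaTerm {q x : ℂ} (hq0 : q ≠ 0) (hq : ‖q‖ < 1) (hx : x ≠ 0) :
    HasSum (thetaTerm q x) (qPochInf q q * qPochInf x q * qPochInf (q / x) q) := by
  have hP := qPochInf_ne_zero_of_norm_lt_one hq hq
  have ht : Tendsto (fun n : ℕ => qFactInv q (n + n)) atTop (𝓝 (qPochInf q q)⁻¹) :=
    (tendsto_qFactInv hq).comp
      (tendsto_natCast_atTop_atTop.atTop_add_atTop tendsto_natCast_atTop_atTop)
  convert hasSum_of_hasSum_mul_qFactInv hq (summable_norm_thetaTerm hq0 hq hx) (fun k => k)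
    (fun k => -k) (fun n => by simpa only [sub_eq_add_neg] using
      hasSum_thetaTerm_mul_qFactInv hq0 hq hx n n)
    (((tendsto_qPoch x q hq).mul (tendsto_qPoch (q / x) q hq)).mul ht) using 1
  field_simp

/-! ### Partial fractions of the reciprocal of a theta product -/

/-- The partial fraction expansion of `1 / ((z;q)_{a+1} (q/z;q)_b)` in `z`. The induction steps
rest on the vanishing of the finite theta sums at `x = 1` and at `x = q`. -/
theorem hasSum_thetaTerm_div_mul_qFactInv {q z : ℂ} (hq0 : q ≠ 0) (hq : ‖q‖ < 1) (hz : z ≠ 0)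
    (hzq : ∀ k : ℤ, 1 - z * q ^ k ≠ 0) (a b : ℕ) :
    HasSum (fun k : ℤ => thetaTerm q q k / (1 - z * q ^ k) * qFactInv q (b + k) *
      qFactInv q (a - k)) (qPoch z q (a + 1) * qPoch (q / z) q b)⁻¹ := by
  induction b with
  | zero =>
    induction a with
    | zero =>
      convert hasSum_single (0 : ℤ) fun k hk => ?_ using 1
      · simp [thetaTerm_zero, qFactInv_zero, qPoch]
      · rcases lt_or_gt_of_ne hk with h | h
        · simp [qFactInv_of_neg q h]
        · simp [qFactInv_of_neg q (neg_lt_zero.2 h)]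
    | succ a ih =>
      have h0 := hzq (a + 1 : ℕ)
      rw [zpow_natCast] at h0
      have h2 := (hasSum_thetaTerm_mul_qFactInv hq0 hq one_ne_zero (a + 1) 0).mul_left (q ^ (a + 1))
      rw [qPoch_one_succ, zero_mul, zero_mul, mul_zero] at h2
      refine HasSum.congr_eq ((ih.add h2).mul_right (1 - z * q ^ (a + 1))⁻¹) (fun k => ?_) ?_
      · have e := qFactInv_eq_mul_qFactInv_add_one hq (a - k)
        have hk := zpow_ne_zero k hq0
        have hzk := hzq k
        have et := thetaTerm_mul q 1 q k
        rw [one_mul] at et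
        rw [show (a : ℤ) - k + 1 = a + 1 - k by ring, zpow_sub₀ hq0, zpow_add_one₀ hq0,
          zpow_natCast] at e
        simp only [Nat.cast_succ]
        rw [e, et, eq_mul_inv_iff_mul_eq₀ h0]
        have hzk' : 1 - q ^ k * z ≠ 0 := by rwa [mul_comm]
        field_simp
        ring
      · rw [add_zero, qPoch_succ z q (a + 1), ← mul_inv]
        ring
  | succ b ih =>
    have h0 : 1 - q / z * q ^ b ≠ 0 := by
      have h := hzq (-(b + 1 : ℕ))
      rw [zpow_neg, zpow_natCast] at h
      contrapose! h
      have hb := pow_ne_zero b hq0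
      field_simp at h ⊢
      linear_combination -h
    have h2 := (hasSum_thetaTerm_mul_qFactInv hq0 hq hq0 a (b + 1)).mul_left (-(q / z * q ^ b))
    rw [div_self hq0, qPoch_one_succ, mul_zero, zero_mul, mul_zero] at h2
    refine HasSum.congr_eq ((ih.add h2).mul_right (1 - q / z * q ^ b)⁻¹) (fun k => ?_) ?_
    · have e := qFactInv_eq_mul_qFactInv_add_one hq (b + k)
      have hk := zpow_ne_zero k hq0
      have hzk := hzq k
      rw [show (b : ℤ) + k + 1 = b + 1 + k by ring, zpow_add₀ hq0, zpow_add_one₀ hq0,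
        zpow_natCast] at e
      simp only [Nat.cast_succ]
      rw [e, eq_mul_inv_iff_mul_eq₀ h0]
      field_simp
      ring
    · rw [add_zero, qPoch_succ (q / z) q b, ← mul_inv]
      ring

/-! ### The Lambert series -/

theorem thetaTerm_self {q : ℂ} (hq0 : q ≠ 0) (k : ℤ) :
    thetaTerm q q k = (-1) ^ k * q ^ (k * (k + 1) / 2) := by
  have h : k * (k + 1) / 2 = k * (k - 1) / 2 + k := by
    rw [show k * (k + 1) = k * (k - 1) + k * 2 by ring, Int.add_mul_ediv_right _ _ two_ne_zero]
  rw [thetaTerm, h, zpow_add₀ hq0, mul_assoc]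

theorem thetaTerm_self_neg_add_one {q : ℂ} (hq0 : q ≠ 0) (k : ℤ) :
    thetaTerm q q (-(k + 1)) = -thetaTerm q q k := by
  rw [thetaTerm_self hq0, thetaTerm_self hq0,
    show -(k + 1) * (-(k + 1) + 1) = k * (k + 1) by ring, zpow_neg,
    zpow_add_one₀ (neg_ne_zero.2 one_ne_zero), mul_inv, ← inv_zpow]
  norm_num

theorem thetaTerm_self_natCast_mul_pow {q : ℂ} (hq0 : q ≠ 0) (k : ℕ) :
    thetaTerm q q k * q ^ k = (-1) ^ k * q ^ (k * (k + 3) / 2) := by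
  have h : ((k * (k + 3) / 2 : ℕ) : ℤ) = k * (k + 1) / 2 + k := by
    push_cast
    rw [show (k : ℤ) * (k + 3) = k * (k + 1) + k * 2 by ring,
      Int.add_mul_ediv_right _ _ two_ne_zero]
  rw [thetaTerm_self hq0, ← zpow_natCast q (k * (k + 3) / 2), h, zpow_add₀ hq0, zpow_natCast,
    zpow_natCast, mul_assoc]

/-- The terms are `O(|q|^k)`, since `k ≤ k(k+3)/2` and `|1 - q^{2k+1}| ≥ 1 - |q|`. -/
theorem summable_norm_lambertTerm {q : ℂ} (hq : ‖q‖ < 1) :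
    Summable fun k : ℕ => ‖(-1 : ℂ) ^ k * q ^ (k * (k + 3) / 2) / (1 - q ^ (2 * k + 1))‖ := by
  have h1 : 0 < 1 - ‖q‖ := sub_pos.2 hq
  refine Summable.of_nonneg_of_le (fun _ => norm_nonneg _) (fun k => ?_)
    ((summable_geometric_of_lt_one (norm_nonneg q) hq).div_const (1 - ‖q‖))
  rw [norm_div, norm_mul, norm_pow, norm_pow, norm_neg, norm_one, one_pow, one_mul]
  have hk : k ≤ k * (k + 3) / 2 := by
    rw [Nat.le_div_iff_mul_le two_pos]
    exact Nat.mul_le_mul_left k (by omega)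
  have hd : 1 - ‖q‖ ≤ ‖1 - q ^ (2 * k + 1)‖ := by
    have h2 := norm_sub_norm_le 1 (q ^ (2 * k + 1))
    have h3 := pow_le_of_le_one (norm_nonneg q) hq.le (show 2 * k + 1 ≠ 0 by omega)
    rw [norm_one, norm_pow] at h2
    linarith
  exact div_le_div₀ (pow_nonneg (norm_nonneg q) k)
    (pow_le_pow_of_le_one (norm_nonneg q) hq.le hk) h1 hd

/-- The points `z = ± s` are no poles `z = q^{-k}`, where `q = s²`: `|z q^k|` is an odd power
of `|s|`. -/
theorem one_sub_mul_sq_zpow_ne_zero {s z : ℂ} (hs0 : s ≠ 0) (hs : ‖s‖ < 1) (hz : ‖z‖ = ‖s‖)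
    (k : ℤ) : 1 - z * (s ^ 2) ^ k ≠ 0 := by
  intro h
  have h1 := congrArg norm (sub_eq_zero.1 h)
  rw [norm_mul, hz, norm_one, norm_zpow, norm_pow, ← zpow_natCast, ← zpow_mul, mul_comm,
    ← zpow_add_one₀ (norm_ne_zero_iff.2 hs0), eq_comm,
    zpow_eq_one_iff_right₀ (norm_nonneg s) hs.ne] at h1
  omega

/-- A finite form of the Lambert series: the difference of the partial fraction expansions at
`z = s` and `z = -s`, where `q = s²`, with the terms of index `k` and `-(k + 1)` joined. -/
theorem hasSum_lambertTerm_mul_qFactInv {s : ℂ} (hs0 : s ≠ 0) (hs : ‖s‖ < 1) (n : ℕ) :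
    HasSum (fun k : ℕ => 4 * s * ((-1 : ℂ) ^ k * (s ^ 2) ^ (k * (k + 3) / 2) /
        (1 - (s ^ 2) ^ (2 * k + 1))) * qFactInv (s ^ 2) (n + (k + 1)) * qFactInv (s ^ 2) (n + -k))
      ((qPoch s (s ^ 2) (n + 1) ^ 2)⁻¹ - (qPoch (-s) (s ^ 2) (n + 1) ^ 2)⁻¹) := by
  have hq0 : s ^ 2 ≠ 0 := pow_ne_zero 2 hs0
  have hq := norm_pow_lt_one hs two_ne_zero
  have hp := one_sub_mul_sq_zpow_ne_zero hs0 hs rfl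
  have hm := one_sub_mul_sq_zpow_ne_zero hs0 hs (norm_neg s)
  have h1 := hasSum_thetaTerm_div_mul_qFactInv hq0 hq hs0 hp n (n + 1)
  have h2 := hasSum_thetaTerm_div_mul_qFactInv hq0 hq (neg_ne_zero.2 hs0) hm n (n + 1)
  rw [show s ^ 2 / s = s by field_simp] at h1
  rw [show s ^ 2 / -s = -s by field_simp] at h2
  refine (h1.sub h2).nat_add_neg_add_one.congr_eq (fun k => ?_) 
    (by rw [pow_two (qPoch s _ _), pow_two (qPoch (-s) _ _)])
  have e1 := hp k
  have e2 := hm k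
  have e3 := hp (-(k + 1))
  have e4 := hm (-(k + 1))
  have hk : (s ^ 2) ^ k ≠ 0 := pow_ne_zero k hq0
  have hd : 1 - (s ^ 2) ^ (2 * k + 1) ≠ 0 := one_sub_pow_ne_zero hq (by omega)
  rw [zpow_neg, zpow_add_one₀ hq0, zpow_natCast] at e3 e4
  rw [zpow_natCast] at e1 e2
  rw [← thetaTerm_self_natCast_mul_pow hq0, thetaTerm_self_neg_add_one hq0, zpow_neg,
    zpow_add_one₀ hq0, zpow_natCast,
    show ((n + 1 : ℕ) : ℤ) + -((k : ℤ) + 1) = n + -k by push_cast; ring,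
    show (n : ℤ) - -((k : ℤ) + 1) = n + (k + 1) by ring,
    show ((n + 1 : ℕ) : ℤ) + (k : ℤ) = n + (k + 1) by push_cast; ring, sub_eq_add_neg (n : ℤ) k]
  -- with `u = q^k`: `1/(1 - su) - 1/(1 + su) = 2su / (1 - qu²)`, and the terms of index `-(k + 1)`
  -- give the same
  have hf : 1 - (s ^ 2) ^ (2 * k + 1) = (1 - s * (s ^ 2) ^ k) * (1 - -s * (s ^ 2) ^ k) := by ring
  have e5 : s * (s ^ 2) ^ k - 1 ≠ 0 := by rwa [← neg_ne_zero, neg_sub]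
  have e6 : 1 + s * (s ^ 2) ^ k ≠ 0 := by simpa using e2
  have h3 : 1 / (1 - s * ((s ^ 2) ^ k * s ^ 2)⁻¹) = s * (s ^ 2) ^ k / (s * (s ^ 2) ^ k - 1) := by
    rw [div_eq_div_iff e3 e5]
    field_simp
  have h4 : 1 / (1 - -s * ((s ^ 2) ^ k * s ^ 2)⁻¹) = s * (s ^ 2) ^ k / (1 + s * (s ^ 2) ^ k) := by
    rw [div_eq_div_iff e4 e6]
    field_simp
    ring
  rw [hf, div_eq_mul_one_div (-thetaTerm _ _ _), h3, div_eq_mul_one_div (-thetaTerm _ _ _), h4]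
  rw [neg_mul s, sub_neg_eq_add]
  generalize (s ^ 2) ^ k = u at *
  generalize thetaTerm _ _ _ = t
  field_simp
  ring

/-- With `q = s²`, the Lambert series is, up to the factor `4s`, the difference of the reciprocal
theta products `(q;q)_∞² / ((z;q)_∞ (q/z;q)_∞)` at `z = s` and `z = -s`. -/
theorem hasSum_lambertTerm {s : ℂ} (hs0 : s ≠ 0) (hs : ‖s‖ < 1) :
    HasSum (fun k : ℕ => 4 * s * ((-1 : ℂ) ^ k * (s ^ 2) ^ (k * (k + 3) / 2) /
        (1 - (s ^ 2) ^ (2 * k + 1))))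
      (qPochInf (s ^ 2) (s ^ 2) ^ 2 *
        ((qPochInf s (s ^ 2) ^ 2)⁻¹ - (qPochInf (-s) (s ^ 2) ^ 2)⁻¹)) := by
  have hq := norm_pow_lt_one hs two_ne_zero
  have ht : ∀ z : ℂ, ‖z‖ = ‖s‖ → Tendsto (fun n => (qPoch z (s ^ 2) (n + 1) ^ 2)⁻¹) atTop
      (𝓝 (qPochInf z (s ^ 2) ^ 2)⁻¹) := fun z hz =>
    (((tendsto_qPoch z (s ^ 2) hq).comp (tendsto_add_atTop_nat 1)).pow 2).inv₀
      (pow_ne_zero 2 (qPochInf_ne_zero_of_norm_lt_one (hz.trans_lt hs) hq))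
  refine hasSum_of_hasSum_mul_qFactInv hq ?_ (fun k : ℕ => (k : ℤ) + 1)
    (fun k : ℕ => -(k : ℤ))
    (hasSum_lambertTerm_mul_qFactInv hs0 hs) ((ht s rfl).sub (ht (-s) (norm_neg s)))
  simp only [norm_mul (4 * s)]
  exact (summable_norm_lambertTerm hq).mul_left _

/-! ### Odd squares -/

theorem thetaTerm_sq {s : ℂ} (hs0 : s ≠ 0) (k : ℤ) :
    thetaTerm (s ^ 2) s k = (-1) ^ k * s ^ (k ^ 2) := by
  have h : 2 * (k * (k - 1) / 2) = k * (k - 1) :=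
    Int.mul_ediv_cancel' (even_iff_two_dvd.1 (Int.even_mul_pred_self k))
  rw [thetaTerm, ← zpow_natCast s 2, ← zpow_mul, mul_assoc, ← zpow_add₀ hs0, Nat.cast_two, h]
  congr 2
  ring

/-- Both sides are `2 ∑ s^{m²}`, summed over the odd integers `m`: on the left by the Jacobi triple
product for the base `s²`, on the right, after writing `m = 2k - 1`, for the base `s⁸`. -/
theorem qPochInf_mul_sub_sq {s : ℂ} (hs0 : s ≠ 0) (hs : ‖s‖ < 1) :
    qPochInf (s ^ 2) (s ^ 2) * (qPochInf (-s) (s ^ 2) ^ 2 - qPochInf s (s ^ 2) ^ 2) =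
      4 * s * (qPochInf (s ^ 8) (s ^ 8) * qPochInf (-s ^ 8) (s ^ 8) ^ 2) := by
  have hq0 : s ^ 2 ≠ 0 := pow_ne_zero 2 hs0
  have hq := norm_pow_lt_one hs two_ne_zero
  have hQ0 : s ^ 8 ≠ 0 := pow_ne_zero 8 hs0
  have hQ := norm_pow_lt_one hs (show 8 ≠ 0 by norm_num)
  have h1 := hasSum_thetaTerm hq0 hq hs0
  have h2 := hasSum_thetaTerm hq0 hq (neg_ne_zero.2 hs0)
  have h3 := (hasSum_thetaTerm hQ0 hQ (neg_ne_zero.2 one_ne_zero)).mul_left (2 * s)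
  rw [show s ^ 2 / s = s by field_simp] at h1
  rw [show s ^ 2 / -s = -s by field_simp] at h2
  rw [div_neg, div_one, qPochInf_neg_one hQ] at h3
  have hinj : Function.Injective fun k : ℤ => 2 * k - 1 := fun a b h => by
    simp only at h
    omega
  have h12 := h2.sub h1
  have hneg (k : ℤ) : thetaTerm (s ^ 2) (-s) k = s ^ (k ^ 2) := by
    rw [neg_eq_neg_one_mul s, mul_comm, thetaTerm_mul, thetaTerm_sq hs0, mul_right_comm,
      ← mul_zpow]
    norm_num
  rw [← hinj.hasSum_iff] at h12
  · have h4 := h12.unique (h3.congr_eq (fun k => ?_) rfl)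
    · linear_combination h4
    · have hodd : (-1 : ℂ) ^ (2 * k - 1) = -1 :=
        Odd.neg_one_zpow ⟨k - 1, by ring⟩
      have hexp : (2 * k - 1) ^ 2 = 8 * (k * (k - 1) / 2) + 1 := by
        have h : 2 * (k * (k - 1) / 2) = k * (k - 1) :=
          Int.mul_ediv_cancel' (even_iff_two_dvd.1 (Int.even_mul_pred_self k))
        linear_combination -4 * h
      simp only [Function.comp]
      rw [hneg, thetaTerm_sq hs0, hodd, hexp, thetaTerm, zpow_add_one₀ hs0, zpow_mul,
        mul_right_comm ((-1 : ℂ) ^ k), ← mul_zpow]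
      norm_num
      norm_cast
      ring
  · intro m hm
    have hev : Even m := by
      rw [← Int.not_odd_iff_even]
      rintro ⟨l, rfl⟩
      exact hm ⟨l + 1, by simp only; ring⟩
    rw [hneg, thetaTerm_sq hs0, hev.neg_one_zpow, one_mul, sub_self]

/-! ### The product formula -/

theorem theorem1p1 (q : ℂ) (hq : ‖q‖ < 1) :
    (∀ k : ℕ, 1 - q ^ (2 * k + 1) ≠ 0) ∧
    qPochInf q (q ^ 2) ≠ 0 ∧
    qPochInf (q ^ 4) (q ^ 8) ≠ 0 ∧
    HasSum (fun k : ℕ => (-1 : ℂ) ^ k * q ^ (k * (k + 3) / 2) / (1 - q ^ (2 * k + 1)))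
      ((qPochInf (q ^ 2) (q ^ 2) * qPochInf (q ^ 8) (q ^ 8)) /
        (qPochInf q (q ^ 2) * qPochInf (q ^ 4) (q ^ 8))) := by
  have hq2 := norm_pow_lt_one hq two_ne_zero
  have hq4 := norm_pow_lt_one hq four_ne_zero
  have hq8 := norm_pow_lt_one hq (show 8 ≠ 0 by norm_num)
  have hO := qPochInf_ne_zero_of_norm_lt_one hq hq2
  have hO4 := qPochInf_ne_zero_of_norm_lt_one hq4 hq8
  refine ⟨fun k => one_sub_pow_ne_zero hq (by omega), hO, hO4, ?_⟩
  -- the theta series involve negative powers of `q`, which leaves `q = 0` to be treated apart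
  rcases eq_or_ne q 0 with rfl | hq0
  · have h0 : qPochInf 0 0 = 1 := by simp [qPochInf]
    convert hasSum_single (0 : ℕ) fun k hk => ?_ using 1
    · simp [h0]
    · have : k * (k + 3) / 2 ≠ 0 := by
        have : 2 ≤ k * (k + 3) := by nlinarith [Nat.pos_of_ne_zero hk]
        omega
      simp [this]
  · obtain ⟨s, rfl⟩ : ∃ s : ℂ, q = s ^ 2 :=
      (IsAlgClosed.exists_pow_nat_eq q two_pos).imp fun s h => h.symm
    have hs0 : s ≠ 0 := fun h => hq0 (by simp [h])
    have hs : ‖s‖ < 1 := by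
      rw [norm_pow] at hq
      exact lt_of_pow_lt_pow_left₀ 2 zero_le_one (by simpa using hq)
    have hA := qPochInf_ne_zero_of_norm_lt_one hs hq
    have hB := qPochInf_ne_zero_of_norm_lt_one ((norm_neg s).trans_lt hs) hq
    have hQ := norm_pow_lt_one hs (show 8 ≠ 0 by norm_num)
    have h1 := qPochInf_mul_qPochInf_neg s hq
    have h2 := qPochInf_even_mul_odd (s ^ 2) hq
    have h3 := qPochInf_mul_qPochInf_neg (s ^ 8) hQ
    have h4 := qPochInf_neg_mul_qPochInf_odd hQ
    have h5 := qPochInf_mul_sub_sq hs0 hs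
    rw [← pow_two] at h2
    rw [show (s ^ 2) ^ 4 = s ^ 8 by ring, show (s ^ 2) ^ 8 = (s ^ 8) ^ 2 by ring] at hO4 ⊢
    have h6 : (qPochInf s (s ^ 2) ^ 2)⁻¹ - (qPochInf (-s) (s ^ 2) ^ 2)⁻¹ =
        (qPochInf (-s) (s ^ 2) ^ 2 - qPochInf s (s ^ 2) ^ 2) /
          qPochInf (s ^ 2) ((s ^ 2) ^ 2) ^ 2 := by
      rw [← h1]
      field_simp
    have h4s : 4 * s ≠ 0 := mul_ne_zero (by norm_num) hs0
    refine ((hasSum_lambertTerm hs0 hs).mul_left (4 * s)⁻¹).congr_eq (fun k => ?_) ?_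
    · rw [inv_mul_cancel_left₀ h4s]
    · rw [h6, eq_inv_mul_iff_mul_eq₀ h4s, mul_div_assoc', mul_div_assoc',
        div_eq_div_iff (mul_ne_zero hO hO4) (pow_ne_zero 2 hO)]
      -- `h5` gives the numerator, `h2`, `h3` and Euler's identity `h4` reduce the products
      linear_combination -qPochInf (s ^ 2) ((s ^ 2) ^ 2) *
        (qPochInf (s ^ 2) (s ^ 2) * qPochInf (s ^ 8) ((s ^ 8) ^ 2) * h5 +
          4 * s * qPochInf (s ^ 2) (s ^ 2) * (qPochInf (s ^ 8) (s ^ 8) *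
            qPochInf (-s ^ 8) (s ^ 8) * h4 + h3) -
          4 * s * qPochInf ((s ^ 8) ^ 2) ((s ^ 8) ^ 2) * h2)
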